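/- Let $0\le k\le n$ and $r\ge 1$ be integers, let $T\subset\mathbb{R}^n$ be a (nondegenerate, closed) $n$-simplex, and let $e$ be an integrable function on $T$ with $e(x)>0$ for every $x\in T$. For an integer $s$ let $\mathcal{P}_s\Lambda^{k}$ (respectively $\mathcal{H}_s\Lambda^{k}$) be the space of differential $k$-forms on $\mathbb{R}^n$ whose coefficients are polynomials of degree at most $s$ (respectively homogeneous polynomials of degree $s$), these spaces being $\{0\}$ for $s<0$. Let $$\mathcal{P}_r^-\Lambda^k=\mathcal{P}_{r-1}\Lambda^k+\kappa\,\mathcal{H}_{r-1}\Lambda^{k+1},\qquad (\kappa\omega)_x(v_1,\dots,v_k)=\omega_x(x,v_1,\dots,v_k),$$ and let $\mathring{\mathcal{P}}_r^-\Lambda^k(T)$ be the space of all $\omega\in\mathcal{P}_r^-\Lambda^k$ whose trace (pullback) to each facet of $T$ vanishes. If $\omega\in\mathring{\mathcal{P}}_r^-\Lambda^k(T)$ satisfies $$\int_T e(x)\,\omega\wedge\eta=0\qquad\text{for all }\eta\in\mathcal{P}_{r-n+k-1}\Lambda^{n-k},$$ then $\omega=0$. -/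

import Mathlib

open MeasureTheory

noncomputable section

namespace FEEC

/-- The ambient space `ℝⁿ`. -/
abbrev Space (n : ℕ) : Type := EuclideanSpace ℝ (Fin n)

/-- Algebraic `k`-forms on `ℝⁿ`. -/
abbrev Alt (n k : ℕ) : Type := Space n [⋀^Fin k]→ₗ[ℝ] ℝ

/-- (Not necessarily smooth) differential `k`-forms on `ℝⁿ`. -/
abbrev Form (n k : ℕ) : Type := Space n → Alt n k

/-- The space `𝒫_s(ℝⁿ)` of polynomials in `n` variables all of whose monomials have degree at
most `s`. The bound `s` is an integer: for `s < 0` the space is `{0}`. -/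
def polys (n : ℕ) (s : ℤ) : Submodule ℝ (MvPolynomial (Fin n) ℝ) where
  carrier := {p | ∀ d ∈ p.support, (d.degree : ℤ) ≤ s}
  zero_mem' := by simp
  add_mem' := by
    intro p q hp hq d hd
    rcases Finset.mem_union.1 (MvPolynomial.support_add hd) with h | h
    · exact hp d h
    · exact hq d h
  smul_mem' := by
    intro c p hp d hd
    exact hp d (MvPolynomial.support_smul hd)

/-- The space `ℋ_s(ℝⁿ)` of polynomials in `n` variables all of whose monomials have degree
exactly `s`; for `s < 0` the space is `{0}`. -/
def homPolys (n : ℕ) (s : ℤ) : Submodule ℝ (MvPolynomial (Fin n) ℝ) where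
  carrier := {p | ∀ d ∈ p.support, (d.degree : ℤ) = s}
  zero_mem' := by simp
  add_mem' := by
    intro p q hp hq d hd
    rcases Finset.mem_union.1 (MvPolynomial.support_add hd) with h | h
    · exact hp d h
    · exact hq d h
  smul_mem' := by
    intro c p hp d hd
    exact hp d (MvPolynomial.support_smul hd)

/-- The differential `k`-forms on `ℝⁿ` whose coefficients lie in the space `P` of polynomials:
for all constant vectors `v₁, …, v_k` the function `x ↦ ω_x(v₁, …, v_k)` belongs to `P`. -/
def formsWithCoeffs {n : ℕ} (k : ℕ) (P : Submodule ℝ (MvPolynomial (Fin n) ℝ)) :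
    Submodule ℝ (Form n k) where
  carrier := {ω | ∀ v : Fin k → Space n, ∃ p ∈ P,
    ∀ x : Space n, ω x v = MvPolynomial.eval (fun i => x i) p}
  zero_mem' := fun _ => ⟨0, P.zero_mem, by simp⟩
  add_mem' := by
    intro ω η hω hη v
    obtain ⟨p, hp, hp'⟩ := hω v
    obtain ⟨q, hq, hq'⟩ := hη v
    exact ⟨p + q, P.add_mem hp hq, fun x => by simp [hp', hq']⟩
  smul_mem' := by
    intro c ω hω v
    obtain ⟨p, hp, hp'⟩ := hω v
    exact ⟨c • p, P.smul_mem c hp, fun x => by simp [hp', MvPolynomial.smul_eval]⟩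

/-- `𝒫_s Λᵏ`: polynomial `k`-forms of degree at most `s`. -/
def polyForms (n k : ℕ) (s : ℤ) : Submodule ℝ (Form n k) := formsWithCoeffs k (polys n s)

/-- `ℋ_s Λᵏ`: homogeneous polynomial `k`-forms of degree `s`. -/
def homForms (n k : ℕ) (s : ℤ) : Submodule ℝ (Form n k) := formsWithCoeffs k (homPolys n s)

/-- The Koszul operator `(κω)_x(v₁, …, v_k) = ω_x(x, v₁, …, v_k)`. -/
def koszul (n k : ℕ) : Form n (k + 1) →ₗ[ℝ] Form n k where
  toFun ω x := (ω x).curryLeft x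
  map_add' _ _ := rfl
  map_smul' _ _ := rfl

/-- `𝒫_r⁻Λᵏ = 𝒫_{r-1}Λᵏ + κ ℋ_{r-1}Λᵏ⁺¹`. -/
def trimmedForms (n k : ℕ) (r : ℤ) : Submodule ℝ (Form n k) :=
  polyForms n k (r - 1) ⊔ (homForms n (k + 1) (r - 1)).map (koszul n k)

/-- The trace (pullback under the inclusion) of `ω` on the subsimplex of `T` spanned by the
vertices with index in `s` is zero: `ω_x` vanishes on vectors tangent to that subsimplex,
for all points `x` of that subsimplex. -/
def TraceVanishesOnFace {n k : ℕ} (T : Affine.Simplex ℝ (Space n) n) (ω : Form n k)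
    (s : Set (Fin (n + 1))) : Prop :=
  ∀ x ∈ convexHull ℝ (T.points '' s), ∀ v : Fin k → Space n,
    (∀ j, v j ∈ vectorSpan ℝ (T.points '' s)) → ω x v = 0

/-- The trace of `ω` on `∂T` is zero: it is zero on each of the `n + 1` facets of `T`. -/
def TraceVanishesOnBoundary {n k : ℕ} (T : Affine.Simplex ℝ (Space n) n) (ω : Form n k) : Prop :=
  ∀ i : Fin (n + 1), TraceVanishesOnFace T ω {i}ᶜ

/-- The wedge product of algebraic forms (the sum over shuffles, without factorial factors). -/
def wedge {n k l : ℕ} (a : Alt n k) (b : Alt n l) : Alt n (k + l) :=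
  ((LinearMap.mul' ℝ ℝ).compAlternatingMap (a.domCoprod b)).domDomCongr finSumFinEquiv

/-- The integral over a set `S ⊆ ℝⁿ` of an `m`-form `α`, where `m = n`, with respect to the
standard orientation: the integral of the coefficient `α(e₁, …, eₙ)` with respect to Lebesgue
measure. -/
def integralForm {n m : ℕ} (h : m = n) (S : Set (Space n)) (α : Form n m) : ℝ :=
  ∫ x in S, α x (fun i => EuclideanSpace.basisFun (Fin n) ℝ (Fin.cast h i))

end FEEC

end

/-! Let `X_j` be the vertices of `T` and `λ_j` the barycentric coordinates. For a tuple `i` of `k`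
distinct vertices, `x ↦ ω_x(X_{i_1} - x, …, X_{i_k} - x)` has degree at most `r`
(`sub_mem_polyFun_of_trimmedForms`) and vanishes on every facet containing all the `X_{i_m}`, where
the arguments are tangent. Hence it equals `(∏ λ_j) B_i`, over the `n + 1 - k` indices `j` outside
the tuple, with `B_i` of degree at most `r - n + k - 1` (`exists_dual_coefficient`).

That is exactly the admissible test degree, so `∑ B_i ω(X_{i_1}, …, X_{i_k})` has zero integral
against `e` (`integral_mul_eq_zero`). The relation `∑ λ_j (X_j - x) = 0` makes `B` sum to zero in
each slot (`sum_update_eq_zero`), so each `X_{i_m}` may be replaced by `X_{i_m} - x`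
(`sum_mul_apply_sub`). The sum becomes `∑ (∏ λ_j) B_i²`, nonnegative inside `T`, so every `B_i`
vanishes there. The vectors `X_j - x` span, so `ω` vanishes on the interior, and everywhere since it
is polynomial. -/

namespace FEEC

/-! ### Evaluation on vectors as a wedge product -/

/-- The alternating form sending `w` to the minor of `w` with columns `g`. -/
noncomputable def coordMinor {n l : ℕ} (g : Fin l → Fin n) : Alt n l :=
  Matrix.detRowAlternating.compLinearMap
    (LinearMap.pi fun q => (EuclideanSpace.proj (g q) : Space n →L[ℝ] ℝ).toLinearMap)

theorem coordMinor_apply {n l : ℕ} (g : Fin l → Fin n) (w : Fin l → Space n) :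
    coordMinor g w = (Matrix.of fun p q => w p (g q)).det := rfl

theorem coordMinor_basisFun_self {n l : ℕ} {g : Fin l → Fin n} (hg : Function.Injective g) :
    coordMinor g (fun i => EuclideanSpace.basisFun (Fin n) ℝ (g i)) = 1 := by
  rw [coordMinor_apply, ← Matrix.det_one (n := Fin l)]
  congr 1
  ext p q
  simp [Matrix.one_apply, hg.eq_iff, eq_comm]

theorem coordMinor_basisFun_of_notMem_range {n l : ℕ} (g h : Fin l → Fin n) (p : Fin l)
    (hp : h p ∉ Set.range g) :
    coordMinor g (fun i => EuclideanSpace.basisFun (Fin n) ℝ (h i)) = 0 := by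
  rw [coordMinor_apply]
  refine Matrix.det_eq_zero_of_row_eq_zero p fun q => ?_
  have : g q ≠ h p := fun e => hp ⟨q, e⟩
  simp [this]

theorem wedge_apply {n k l : ℕ} (a : Alt n k) (b : Alt n l) (v : Fin (k + l) → Space n) :
    wedge a b v = ∑ σ : Equiv.Perm.ModSumCongr (Fin k) (Fin l),
      LinearMap.mul' ℝ ℝ
        (AlternatingMap.domCoprod.summand a b σ (fun i => v (finSumFinEquiv i))) := by
  simp only [wedge, AlternatingMap.domDomCongr_apply, LinearMap.compAlternatingMap_apply,
    AlternatingMap.domCoprod_apply, sum_apply, map_sum]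
  rfl

theorem mul'_summand_mk {n k l : ℕ} (a : Alt n k) (b : Alt n l)
    (σ : Equiv.Perm (Fin k ⊕ Fin l)) (v : Fin k ⊕ Fin l → Space n) :
    LinearMap.mul' ℝ ℝ (AlternatingMap.domCoprod.summand a b (Quotient.mk'' σ) v) =
      Equiv.Perm.sign σ • (a (fun i => v (σ (Sum.inl i))) * b (fun i => v (σ (Sum.inr i)))) := by
  rw [AlternatingMap.domCoprod.summand_mk'', smul_apply,
    MultilinearMap.domDomCongr_apply, MultilinearMap.domCoprod_apply,
    LinearMap.map_smul_of_tower, LinearMap.mul'_apply]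
  rfl

/-- The wedge product with a fixed form, evaluated on fixed vectors, as a linear map. -/
noncomputable def wedgeEval {n k l : ℕ} (a : Alt n k) (w : Fin (k + l) → Space n) :
    Alt n l →ₗ[ℝ] ℝ where
  toFun b := wedge a b w
  map_add' b c := by
    have h : a.domCoprod (b + c) = a.domCoprod b + a.domCoprod c := by
      simp only [← AlternatingMap.domCoprod'_apply, TensorProduct.tmul_add, map_add]
    simp only [wedge, h, AlternatingMap.domDomCongr_apply, LinearMap.compAlternatingMap_apply]
    exact map_add _ _ _
  map_smul' t b := by
    have h : a.domCoprod (t • b) = t • a.domCoprod b := by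
      simp only [← AlternatingMap.domCoprod'_apply, TensorProduct.tmul_smul, map_smul]
    simp only [wedge, h, AlternatingMap.domDomCongr_apply, LinearMap.compAlternatingMap_apply]
    exact map_smul _ _ _

theorem wedgeEval_apply {n k l : ℕ} (a : Alt n k) (w : Fin (k + l) → Space n) (b : Alt n l) :
    wedgeEval a w b = wedge a b w := rfl

/-- For injective `f`, take as `θ` the signed minor on the complementary indices: a single shuffle
class survives in the wedge. -/
theorem exists_wedge_basisFun_eq {n k l : ℕ} (h : k + l = n) (f : Fin k → Fin n) :
    ∃ θ : Alt n l, ∀ a : Alt n k,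
      wedge a θ (fun i => EuclideanSpace.basisFun (Fin n) ℝ (Fin.cast h i)) =
        a (fun i => EuclideanSpace.basisFun (Fin n) ℝ (f i)) := by
  by_cases hf : Function.Injective f
  swap
  · refine ⟨0, fun a => ?_⟩
    rw [a.map_eq_zero_of_not_injective]
    · exact map_zero (wedgeEval a _)
    · intro hi
      exact hf fun x y hxy => hi (by simp [hxy])
  let E : Fin k ⊕ Fin l ≃ Fin n := finSumFinEquiv.trans (finCongr h)
  obtain ⟨τ, hτ⟩ : ∃ τ : Equiv.Perm (Fin k ⊕ Fin l), ∀ i, τ (Sum.inl i) = E.symm (f i) := by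
    have h1 : Function.Injective (Sum.inl : Fin k → Fin k ⊕ Fin l) := Sum.inl_injective
    have h2 : Function.Injective (fun i => E.symm (f i)) := E.symm.injective.comp hf
    refine ⟨((Equiv.ofInjective _ h1).symm.trans (Equiv.ofInjective _ h2)).extendSubtype,
      fun i => ?_⟩
    rw [Equiv.extendSubtype_apply_of_mem _ _ ⟨i, rfl⟩]
    have := Equiv.ofInjective_symm_apply h1 i
    simp only [Equiv.trans_apply]
    rw [show (⟨Sum.inl i, _⟩ : Set.range (Sum.inl : Fin k → Fin k ⊕ Fin l)) =
      ⟨Sum.inl i, ⟨i, rfl⟩⟩ from rfl, this]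
    rfl
  let g : Fin l → Fin n := fun i => E (τ (Sum.inr i))
  have hg : Function.Injective g :=
    E.injective.comp (τ.injective.comp Sum.inr_injective)
  refine ⟨Equiv.Perm.sign τ • coordMinor g, fun a => ?_⟩
  rw [wedge_apply]
  refine (Fintype.sum_eq_single
    (Quotient.mk'' τ : Equiv.Perm.ModSumCongr (Fin k) (Fin l)) ?_).trans ?_
  swap
  · rw [mul'_summand_mk]
    have h1 := coordMinor_basisFun_self hg
    have h2 : ∀ j, Fin.cast h (finSumFinEquiv j) = E j := fun j => rfl
    simp only [h2, hτ, Equiv.apply_symm_apply]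
    change Equiv.Perm.sign τ • (_ * (Equiv.Perm.sign τ • coordMinor g _)) = _
    rw [show (fun i => EuclideanSpace.basisFun (Fin n) ℝ (E (τ (Sum.inr i)))) =
      fun i => EuclideanSpace.basisFun (Fin n) ℝ (g i) from rfl, h1, mul_smul_comm, smul_smul]
    simp
  · intro σ hσ
    induction σ using Quotient.inductionOn' with
    | h σ =>
    rw [mul'_summand_mk]
    suffices H : coordMinor g (fun i => EuclideanSpace.basisFun (Fin n) ℝ
        (Fin.cast h (finSumFinEquiv (σ (Sum.inr i))))) = 0 by
      change Equiv.Perm.sign σ • (_ * (Equiv.Perm.sign τ • coordMinor g _)) = 0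
      rw [H, smul_zero, mul_zero, smul_zero]
    -- If `σ` sent the second block into `τ`'s second block, `τ⁻¹ * σ` would preserve both blocks,
    -- putting `σ` in the class of `τ`.
    obtain ⟨p, hp⟩ : ∃ p, Fin.cast h (finSumFinEquiv (σ (Sum.inr p))) ∉ Set.range g := by
      by_contra! hcon
      apply hσ
      refine Quotient.sound' ?_
      rw [QuotientGroup.leftRel_apply]
      rw [← inv_mem_iff]
      have key : Set.MapsTo (τ⁻¹ * σ) (Set.range Sum.inr) (Set.range Sum.inr) := by
        rintro _ ⟨p, rfl⟩
        obtain ⟨q, hq⟩ := hcon p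
        refine ⟨q, ?_⟩
        have : τ (Sum.inr q) = σ (Sum.inr p) := E.injective hq
        simp [← this]
      rw [mul_inv_rev, inv_inv]
      have := Equiv.Perm.mem_sumCongrHom_range_of_perm_mapsTo_inl (σ := τ⁻¹ * σ) ?_
      · simpa using this
      · exact (Equiv.Perm.perm_mapsTo_inl_iff_mapsTo_inr _).2 key
    exact coordMinor_basisFun_of_notMem_range g _ p hp

theorem exists_wedge_eq_apply {n k l : ℕ} (h : k + l = n) (v : Fin k → Space n) :
    ∃ θ : Alt n l, ∀ a : Alt n k,
      wedge a θ (fun i => EuclideanSpace.basisFun (Fin n) ℝ (Fin.cast h i)) = a v := by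
  choose θ hθ using exists_wedge_basisFun_eq (k := k) h
  let b := EuclideanSpace.basisFun (Fin n) ℝ
  refine ⟨∑ f : Fin k → Fin n, (∏ i, v i (f i)) • θ f, fun a => ?_⟩
  have hv : v = fun i => ∑ j, v i j • b j := by
    funext i
    simpa [b] using ((EuclideanSpace.basisFun (Fin n) ℝ).sum_repr (v i)).symm
  conv_rhs => rw [hv]
  have := a.toMultilinearMap.map_sum (fun i j => v i j • b j)
  rw [AlternatingMap.coe_multilinearMap] at this
  rw [← wedgeEval_apply, this, map_sum]
  refine Finset.sum_congr rfl fun f _ => ?_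
  have h2 := a.toMultilinearMap.map_smul_univ (fun i => v i (f i)) (fun i => b (f i))
  rw [AlternatingMap.coe_multilinearMap] at h2
  rw [h2, map_smul, wedgeEval_apply, hθ]

/-! ### Polynomial functions and their degrees -/

theorem polys_mul_mem {n : ℕ} {s t : ℤ} {p q : MvPolynomial (Fin n) ℝ} (hp : p ∈ polys n s)
    (hq : q ∈ polys n t) : p * q ∈ polys n (s + t) := by
  intro d hd
  obtain ⟨a, ha, b, hb, rfl⟩ := Finset.mem_add.1 (MvPolynomial.support_mul p q hd)
  have h1 := hp a ha
  have h2 := hq b hb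
  rw [map_add]
  push_cast
  linarith

/-- The functions on `ℝⁿ` given by polynomials in `polys n s`. -/
def polyFun (n : ℕ) (s : ℤ) : Submodule ℝ (Space n → ℝ) where
  carrier := {f | ∃ p ∈ polys n s, ∀ x : Space n, f x = MvPolynomial.eval (fun i => x i) p}
  zero_mem' := ⟨0, (polys n s).zero_mem, by simp⟩
  add_mem' := by
    rintro f g ⟨p, hp, hp'⟩ ⟨q, hq, hq'⟩
    exact ⟨p + q, (polys n s).add_mem hp hq, fun x => by simp [hp', hq']⟩
  smul_mem' := by
    rintro c f ⟨p, hp, hp'⟩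
    exact ⟨c • p, (polys n s).smul_mem c hp, fun x => by simp [hp', MvPolynomial.smul_eval]⟩

theorem homForms_le_polyForms (n k : ℕ) (s : ℤ) : homForms n k s ≤ polyForms n k s := by
  intro ω hω v
  obtain ⟨p, hp, hp'⟩ := hω v
  exact ⟨p, fun d hd => (hp d hd).le, hp'⟩

theorem polyFun_mono {n : ℕ} {s t : ℤ} (h : s ≤ t) : polyFun n s ≤ polyFun n t := by
  rintro f ⟨p, hp, hp'⟩
  exact ⟨p, fun d hd => (hp d hd).trans h, hp'⟩

theorem polyFun_mul_mem {n : ℕ} {s t : ℤ} {f g : Space n → ℝ} (hf : f ∈ polyFun n s)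
    (hg : g ∈ polyFun n t) : (fun x => f x * g x) ∈ polyFun n (s + t) := by
  obtain ⟨p, hp, hp'⟩ := hf
  obtain ⟨q, hq, hq'⟩ := hg
  exact ⟨p * q, polys_mul_mem hp hq, fun x => by simp [hp', hq']⟩

theorem const_mem_polyFun {n : ℕ} (c : ℝ) : (fun _ => c) ∈ polyFun n 0 := by
  refine ⟨MvPolynomial.C c, fun d hd => ?_, by simp⟩
  rw [MvPolynomial.C_apply] at hd
  have := MvPolynomial.support_monomial_subset hd
  rw [Finset.mem_singleton] at this
  simp [this]

theorem coord_mem_polyFun {n : ℕ} (q : Fin n) : (fun x : Space n => x q) ∈ polyFun n 1 := by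
  refine ⟨MvPolynomial.X q, fun d hd => ?_, by simp⟩
  rw [MvPolynomial.support_X, Finset.mem_singleton] at hd
  simp [hd]

theorem pow_mem_polyFun {n : ℕ} {f : Space n → ℝ} (hf : f ∈ polyFun n 1) (m : ℕ) :
    (fun x => f x ^ m) ∈ polyFun n m := by
  induction m with
  | zero => simpa using const_mem_polyFun 1
  | succ m ih =>
    push_cast
    simpa only [pow_succ] using polyFun_mul_mem ih hf

theorem prod_mem_polyFun {n : ℕ} {ι : Type*} (s : Finset ι) (f : ι → Space n → ℝ) (m : ι → ℕ)
    (hf : ∀ i ∈ s, f i ∈ polyFun n (m i)) :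
    (fun x => ∏ i ∈ s, f i x) ∈ polyFun n (∑ i ∈ s, m i : ℕ) := by
  classical
  induction s using Finset.induction_on with
  | empty => simpa using const_mem_polyFun 1
  | insert a s ha ih =>
    simp only [Finset.prod_insert ha, Finset.sum_insert ha]
    push_cast
    have := ih fun i hi => hf i (Finset.mem_insert_of_mem hi)
    push_cast at this
    exact polyFun_mul_mem (hf a (Finset.mem_insert_self _ _)) this

theorem sum_mem_polyFun {n : ℕ} {s : ℤ} {ι : Type*} (t : Finset ι) (f : ι → Space n → ℝ)
    (hf : ∀ i ∈ t, f i ∈ polyFun n s) : (fun x => ∑ i ∈ t, f i x) ∈ polyFun n s := by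
  have : (fun x => ∑ i ∈ t, f i x) = ∑ i ∈ t, f i := by ext x; simp
  rw [this]
  exact Submodule.sum_mem _ hf

theorem eval_comp_mem_polyFun {n m : ℕ} {s : ℤ} {Q : MvPolynomial (Fin m) ℝ}
    (hQ : ∀ d ∈ Q.support, (d.degree : ℤ) ≤ s) {l : Fin m → Space n → ℝ}
    (hl : ∀ j, l j ∈ polyFun n 1) :
    (fun x => MvPolynomial.eval (fun j => l j x) Q) ∈ polyFun n s := by
  simp only [MvPolynomial.eval_eq']
  refine sum_mem_polyFun _ _ fun d hd => polyFun_mono (hQ d hd) ?_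
  rw [← zero_add (d.degree : ℤ), Finsupp.degree_eq_sum]
  exact polyFun_mul_mem (const_mem_polyFun _)
    (prod_mem_polyFun _ _ _ fun i _ => pow_mem_polyFun (hl i) _)

theorem continuous_of_mem_polyFun {n : ℕ} {s : ℤ} {f : Space n → ℝ} (hf : f ∈ polyFun n s) :
    Continuous f := by
  obtain ⟨p, -, hp⟩ := hf
  rw [funext hp]
  exact (MvPolynomial.continuous_eval p).comp (by fun_prop)

theorem eq_zero_of_mem_polyFun {n : ℕ} {s : ℤ} {f : Space n → ℝ} (hf : f ∈ polyFun n s)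
    {U : Set (Space n)} (hU : IsOpen U) (hne : U.Nonempty) (h : ∀ x ∈ U, f x = 0) : f = 0 := by
  obtain ⟨p, -, hp⟩ := hf
  obtain ⟨z, hz⟩ := hne
  have ha : AnalyticOnNhd ℝ f Set.univ := by
    intro x _
    rw [funext hp]
    exact AnalyticAt.aeval_mvPolynomial (f := fun (x : Space n) i => x i) (z := x)
      (fun i => (EuclideanSpace.proj (𝕜 := ℝ) i).analyticAt x) p
  exact ha.eq_of_eventuallyEq (z₀ := z) analyticOnNhd_const
    (Filter.eventually_of_mem (hU.mem_nhds hz) h)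

/-! ### Divisibility by barycentric coordinates -/

/-- Polynomials of degree at most `r` are homogeneous of degree `r` in weights summing to one. -/
theorem exists_isHomogeneous_eval_eq {n m : ℕ} {r : ℕ} {p : MvPolynomial (Fin n) ℝ}
    (hp : p ∈ polys n r) (A : Fin m → Fin n → ℝ) :
    ∃ P : MvPolynomial (Fin m) ℝ, P.IsHomogeneous r ∧ ∀ w : Fin m → ℝ, ∑ j, w j = 1 →
      MvPolynomial.eval (fun q => ∑ j, w j * A j q) p = MvPolynomial.eval w P := by
  -- Each monomial is padded to degree `r` by a power of `∑ X_j`, which equals one on the weights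
  -- considered.
  refine ⟨∑ d ∈ p.support, MvPolynomial.C (p.coeff d) *
    (∏ q, (∑ j, MvPolynomial.C (A j q) * MvPolynomial.X j) ^ d q) *
      (∑ j, MvPolynomial.X j) ^ (r - d.degree), ?_, fun w hw => ?_⟩
  · refine MvPolynomial.IsHomogeneous.sum _ _ _ fun d hd => ?_
    have hd' : d.degree ≤ r := by exact_mod_cast hp d hd
    have h1 : (∏ q, (∑ j, MvPolynomial.C (A j q) * MvPolynomial.X j :
        MvPolynomial (Fin m) ℝ) ^ d q).IsHomogeneous (∑ q, d q) := by
      refine MvPolynomial.IsHomogeneous.prod _ _ _ fun q _ => ?_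
      have := (MvPolynomial.IsHomogeneous.sum Finset.univ
        (fun j => (MvPolynomial.C (A j q) * MvPolynomial.X j : MvPolynomial (Fin m) ℝ)) 1
        fun j _ => (MvPolynomial.isHomogeneous_C_mul_X _ _)).pow (d q)
      simpa using this
    have h2 : ((∑ j, MvPolynomial.X j : MvPolynomial (Fin m) ℝ) ^ (r - d.degree)).IsHomogeneous
        (r - d.degree) := by
      have := (MvPolynomial.IsHomogeneous.sum Finset.univ
        (fun j => (MvPolynomial.X j : MvPolynomial (Fin m) ℝ)) 1
        fun j _ => (MvPolynomial.isHomogeneous_X _ _)).pow (r - d.degree)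
      simpa using this
    have h3 := ((MvPolynomial.isHomogeneous_C (Fin m) (p.coeff d)).mul h1).mul h2
    rw [← Finsupp.degree_eq_sum] at h3
    convert h3 using 1
    omega
  · rw [MvPolynomial.eval_eq']
    simp [hw, mul_comm]

/-- A homogeneous polynomial vanishing on the facets `w j = 0` of the standard simplex for `j ∈ J`
is divisible by the product of the corresponding variables. -/
theorem exists_eq_prod_X_mul {m r : ℕ} (hr : 1 ≤ r) {P : MvPolynomial (Fin m) ℝ}
    (hP : P.IsHomogeneous r) (J : Finset (Fin m))
    (h : ∀ j ∈ J, ∀ w : Fin m → ℝ, (∀ i, 0 ≤ w i) → ∑ i, w i = 1 → w j = 0 →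
      MvPolynomial.eval w P = 0) :
    ∃ Q : MvPolynomial (Fin m) ℝ, P = (∏ j ∈ J, MvPolynomial.X j) * Q ∧
      ∀ d ∈ Q.support, d.degree + J.card = r := by
  -- Homogeneity carries the vanishing from the standard simplex to the whole orthant; at the origin
  -- this needs `r ≥ 1`.
  have hnn : ∀ j ∈ J, ∀ w : Fin m → ℝ, (∀ i, 0 ≤ w i) → w j = 0 → MvPolynomial.eval w P = 0 := by
    intro j hj w hw hwj
    have hs : 0 ≤ ∑ i, w i := Finset.sum_nonneg fun i _ => hw i
    have hscale : ∀ (c : ℝ) (u : Fin m → ℝ),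
        MvPolynomial.eval (fun i => c * u i) P = c ^ r * MvPolynomial.eval u P := by
      intro c u
      rw [MvPolynomial.eval_eq', MvPolynomial.eval_eq', Finset.mul_sum]
      refine Finset.sum_congr rfl fun d hd => ?_
      have hd' : ∑ i, d i = r := by
        rw [← Finsupp.degree_eq_sum, Finsupp.degree_eq_weight_one]
        exact hP (MvPolynomial.mem_support_iff.1 hd)
      simp only [mul_pow, Finset.prod_mul_distrib, Finset.prod_pow_eq_pow_sum, hd']
      ring
    rcases hs.eq_or_lt with hs | hs
    · have hw0 : w = fun i => 0 * w i := by
        funext i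
        rw [zero_mul]
        exact (Finset.sum_eq_zero_iff_of_nonneg fun i _ => hw i).1 hs.symm i (Finset.mem_univ i)
      rw [hw0, hscale, zero_pow (by omega), zero_mul]
    · have hw0 : w = fun i => (∑ i, w i) * (w i / ∑ i, w i) := by
        funext i
        field_simp
      rw [hw0, hscale, h j hj _ (fun i => div_nonneg (hw i) hs.le)
        (by rw [← Finset.sum_div, div_self hs.ne']) (by simp [hwj]), mul_zero]
  have hmon : ∀ j ∈ J, ∀ d ∈ P.support, d j ≠ 0 := by
    intro j hj d hd hdj
    set R := P.modMonomial (Finsupp.single j 1) with hR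
    have hRj : ∀ d ∈ R.support, d j = 0 := by
      intro d hd
      by_contra hne
      refine MvPolynomial.mem_support_iff.1 hd (MvPolynomial.coeff_modMonomial_of_le _ ?_)
      simpa [Finsupp.single_le_iff] using Nat.one_le_iff_ne_zero.2 hne
    -- Setting `w j = 0` kills the part divisible by `X_j` and leaves `R` unchanged, so `R` vanishes
    -- on the open orthant.
    have hR0 : R = 0 := by
      refine MvPolynomial.funext_set (fun _ => Set.Ioi (0 : ℝ)) (fun _ => Set.Ioi_infinite 0)
        fun w hw => ?_
      have hw' : ∀ i, 0 < w i := fun i => hw i (Set.mem_univ i)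
      have h0 := hnn j hj (Function.update w j 0) (fun i => by
        rcases eq_or_ne i j with rfl | hij
        · simp
        · simpa [hij] using (hw' i).le) (by simp)
      rw [← MvPolynomial.divMonomial_add_modMonomial_single P j, ← hR] at h0
      simp only [map_add, map_mul, MvPolynomial.eval_X, Function.update_self, zero_mul,
        zero_add] at h0
      rw [map_zero, ← h0, MvPolynomial.eval_eq', MvPolynomial.eval_eq']
      refine Finset.sum_congr rfl fun d hd => ?_
      congr 1
      refine Finset.prod_congr rfl fun i _ => ?_
      rcases eq_or_ne i j with rfl | hij
      · simp [hRj d hd]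
      · simp [hij]
    refine MvPolynomial.mem_support_iff.1 hd ?_
    rw [← MvPolynomial.coeff_modMonomial_of_not_le (s' := d) (s := Finsupp.single j 1) P
      (by simp [Finsupp.single_le_iff, hdj]), ← hR, hR0, MvPolynomial.coeff_zero]
  have hle : ∀ d ∈ P.support, (∑ j ∈ J, Finsupp.single j 1) ≤ d := by
    intro d hd i
    rw [Finsupp.finsetSum_apply]
    simp only [Finsupp.single_apply, Finset.sum_ite_eq']
    split_ifs with hi
    · exact Nat.one_le_iff_ne_zero.2 (hmon i hi d hd)
    · exact Nat.zero_le _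
  have hX : (∏ j ∈ J, MvPolynomial.X j : MvPolynomial (Fin m) ℝ) =
      MvPolynomial.monomial (∑ j ∈ J, Finsupp.single j 1) 1 := by
    rw [MvPolynomial.monomial_sum_one]
    rfl
  refine ⟨P.divMonomial (∑ j ∈ J, Finsupp.single j 1), ?_, fun d hd => ?_⟩
  · rw [hX]
    ext d
    rw [MvPolynomial.coeff_monomial_mul']
    split_ifs with hd
    · rw [one_mul, MvPolynomial.coeff_divMonomial, add_tsub_cancel_of_le hd]
    · by_contra hne
      exact hd (hle d (MvPolynomial.mem_support_iff.2 hne))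
  · rw [MvPolynomial.mem_support_iff, MvPolynomial.coeff_divMonomial] at hd
    have h1 : ((∑ j ∈ J, Finsupp.single j 1) + d).degree = r := by
      rw [Finsupp.degree_eq_weight_one]
      exact hP hd
    have h2 : (∑ j ∈ J, (Finsupp.single j 1 : Fin m →₀ ℕ)).degree = J.card := by
      simp
    rw [map_add, h2] at h1
    omega

/-! ### Forms evaluated on vectors pointing from the base point -/

theorem alt_apply_sub_eq_sum {n k : ℕ} (f : Alt n k) (u : Fin k → Space n) (x : Space n) :
    f (fun m => u m - x) =
      ∑ s : Finset (Fin k), f (s.piecewise u (fun _ => -x)) := by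
  rw [← f.map_add_univ]
  congr 1

theorem update_mem_polyFun {n k : ℕ} {s : ℤ} {ω : Form n k} (hω : ω ∈ polyForms n k s)
    (v : Fin k → Space n) (m : Fin k) :
    (fun x => ω x (Function.update v m x)) ∈ polyFun n (s + 1) := by
  have h : ∀ x, ω x (Function.update v m x) =
      ∑ q, x q * ω x (Function.update v m (EuclideanSpace.basisFun (Fin n) ℝ q)) := by
    intro x
    have h1 := (EuclideanSpace.basisFun (Fin n) ℝ).sum_repr x
    have h2 := congrArg ((ω x).toMultilinearMap.toLinearMap v m) h1
    rw [map_sum] at h2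
    simp only [map_smul, smul_eq_mul, MultilinearMap.toLinearMap_apply] at h2
    simpa using h2.symm
  rw [funext h]
  refine sum_mem_polyFun _ _ fun q _ => ?_
  rw [add_comm s]
  exact polyFun_mul_mem (coord_mem_polyFun q) (hω _)

/-- The degree rises by one only, not by `k`: in the multilinear expansion, terms with `x` in two
slots vanish. -/
theorem sub_mem_polyFun_of_polyForms {n k : ℕ} {s : ℤ} {ω : Form n k} (hω : ω ∈ polyForms n k s)
    (u : Fin k → Space n) : (fun x => ω x (fun m => u m - x)) ∈ polyFun n (s + 1) := by
  simp only [alt_apply_sub_eq_sum]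
  refine sum_mem_polyFun _ _ fun t _ => ?_
  by_cases h1 : ∀ m, m ∈ t
  · obtain rfl : t = Finset.univ := Finset.eq_univ_of_forall h1
    simp only [Finset.piecewise_univ]
    exact polyFun_mono (by omega) (hω u)
  push Not at h1
  obtain ⟨m, hm⟩ := h1
  by_cases h2 : ∀ p, p ≠ m → p ∈ t
  · have : ∀ x, ω x (t.piecewise u (fun _ => -x)) = (-1 : ℝ) • ω x (Function.update u m x) := by
      intro x
      rw [← AlternatingMap.map_update_smul]
      congr 1
      funext p
      rcases eq_or_ne p m with rfl | hp
      · simp [hm]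
      · simp [hp, h2 p hp]
    rw [funext this]
    exact Submodule.smul_mem _ _ (update_mem_polyFun hω u m)
  · push Not at h2
    obtain ⟨p, hp, hpt⟩ := h2
    have : ∀ x, ω x (t.piecewise u (fun _ => -x)) = 0 := fun x =>
      (ω x).map_eq_zero_of_eq _ (by simp [hm, hpt]) hp
    rw [funext this]
    exact Submodule.zero_mem _

theorem koszul_apply_eq_update {n k : ℕ} (β : Form n (k + 1)) (x : Space n) (v : Fin k → Space n) :
    koszul n k β x v = β x (Function.update (Fin.cons 0 v : Fin (k + 1) → Space n) 0 x) := by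
  rw [Fin.update_cons_zero]
  rfl

/-- The Koszul operator already inserts `x`, so any further `x` gives a repeated argument. -/
theorem koszul_apply_sub {n k : ℕ} (β : Form n (k + 1)) (x : Space n) (u : Fin k → Space n) :
    koszul n k β x (fun m => u m - x) = koszul n k β x u := by
  rw [alt_apply_sub_eq_sum, Fintype.sum_eq_single Finset.univ, Finset.piecewise_univ]
  intro s hs
  obtain ⟨m, hm⟩ : ∃ m, m ∉ s := by
    by_contra! h
    exact hs (Finset.eq_univ_of_forall h)
  have hu : s.piecewise u (fun _ => -x) =
      Function.update (s.piecewise u (fun _ => -x)) m ((-1 : ℝ) • x) := by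
    conv_lhs => rw [← Function.update_eq_self m (s.piecewise u (fun _ => -x))]
    simp [hm]
  rw [hu, AlternatingMap.map_update_smul, koszul_apply_eq_update,
    (β x).map_eq_zero_of_eq (i := 0) (j := m.succ) _ _ (Fin.succ_ne_zero m).symm, smul_zero]
  simp

theorem sub_mem_polyFun_of_trimmedForms {n k : ℕ} {r : ℤ} {ω : Form n k}
    (hω : ω ∈ trimmedForms n k r) (u : Fin k → Space n) :
    (fun x => ω x (fun m => u m - x)) ∈ polyFun n r := by
  obtain ⟨α, hα, -, ⟨β, hβ, rfl⟩, rfl⟩ := Submodule.mem_sup.1 hω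
  have h1 := sub_mem_polyFun_of_polyForms hα u
  have h2 := update_mem_polyFun (homForms_le_polyForms _ _ _ hβ)
    (Fin.cons 0 u : Fin (k + 1) → Space n) 0
  simp only [← koszul_apply_eq_update] at h2
  rw [sub_add_cancel] at h1 h2
  convert Submodule.add_mem _ h1 h2 using 1
  funext x
  change α x _ + koszul n k β x _ = _
  rw [koszul_apply_sub]
  rfl

theorem apply_mem_polyFun_of_trimmedForms {n k : ℕ} {r : ℤ} {ω : Form n k}
    (hω : ω ∈ trimmedForms n k r) (u : Fin k → Space n) :
    (fun x => ω x u) ∈ polyFun n r := by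
  obtain ⟨α, hα, -, ⟨β, hβ, rfl⟩, rfl⟩ := Submodule.mem_sup.1 hω
  have h2 := update_mem_polyFun (homForms_le_polyForms _ _ _ hβ)
    (Fin.cons 0 u : Fin (k + 1) → Space n) 0
  simp only [← koszul_apply_eq_update] at h2
  rw [sub_add_cancel] at h2
  exact Submodule.add_mem _ (polyFun_mono (by omega) (hα u)) h2

/-! ### Removing the base point from a weighted sum -/

theorem sum_mul_eq_zero_of_sum_update {k N : ℕ} (c g : (Fin k → Fin (N + 1)) → ℝ) (m : Fin k)
    (hc : ∀ i, ∑ j, c (Function.update i m j) = 0)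
    (hg : ∀ i j, g (Function.update i m j) = g i) : ∑ i, c i * g i = 0 := by
  have h := (Equiv.funSplitAt m (Fin (N + 1))).symm.sum_comp (fun i => c i * g i)
  rw [← h, Fintype.sum_prod_type_right]
  refine Finset.sum_eq_zero fun y _ => ?_
  have hu : ∀ j, (Equiv.funSplitAt m (Fin (N + 1))).symm (j, y) =
      Function.update ((Equiv.funSplitAt m (Fin (N + 1))).symm (0, y)) m j := by
    intro j
    funext p
    rcases eq_or_ne p m with rfl | hp
    · simp [Equiv.funSplitAt]
    · simp [Equiv.funSplitAt, hp]
  calc _ = ∑ j, c (Function.update ((Equiv.funSplitAt m (Fin (N + 1))).symm (0, y)) m j) *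
        g ((Equiv.funSplitAt m (Fin (N + 1))).symm (0, y)) :=
        Finset.sum_congr rfl fun j _ => by rw [hu j, hg]
    _ = 0 := by rw [← Finset.sum_mul, hc, zero_mul]

/-- In the expansion, a term with `-y` in slot `m` does not depend on `i m`, so summing over that
index first gives zero. -/
theorem sum_mul_apply_sub {n k N : ℕ} (f : Alt n k) (c : (Fin k → Fin (N + 1)) → ℝ)
    (hc : ∀ m i, ∑ j, c (Function.update i m j) = 0) (X : Fin (N + 1) → Space n) (y : Space n) :
    ∑ i, c i * f (fun m => X (i m) - y) = ∑ i, c i * f (fun m => X (i m)) := by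
  simp only [alt_apply_sub_eq_sum, Finset.mul_sum]
  rw [Finset.sum_comm, Fintype.sum_eq_single Finset.univ]
  · simp
  intro s hs
  obtain ⟨m, hm⟩ : ∃ m, m ∉ s := by
    by_contra! h
    exact hs (Finset.eq_univ_of_forall h)
  refine sum_mul_eq_zero_of_sum_update c _ m (hc m) fun i j => ?_
  congr 1
  funext p
  rcases eq_or_ne p m with rfl | hp
  · simp [hm]
  · simp [Finset.piecewise, hp]

/-- Insert `∑ w j • (X j - x) = 0` into slot `m` of `f`. The factor `w j` completes each product to
the same one, over the indices not used by the other slots; this nonzero product cancels. -/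
theorem sum_update_eq_zero {n k : ℕ} (f : Alt n k) {X : Fin (n + 1) → Space n} {x : Space n}
    {w : Fin (n + 1) → ℝ} (hw : ∀ j, w j ≠ 0) (hw1 : ∑ j, w j = 1) (hx : ∑ j, w j • X j = x)
    {c : (Fin k → Fin (n + 1)) → ℝ} (hc0 : ∀ i, ¬ Function.Injective i → c i = 0)
    (hc : ∀ i, Function.Injective i →
      f (fun m => X (i m) - x) = (∏ j ∈ Finset.univ \ Finset.univ.image i, w j) * c i)
    (m : Fin k) (i : Fin k → Fin (n + 1)) : ∑ j, c (Function.update i m j) = 0 := by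
  set J := Finset.univ \ (Finset.univ.erase m).image i with hJ
  have h1 : ∀ j, (∏ l ∈ J, w l) * c (Function.update i m j) =
      w j * f (fun p => X (Function.update i m j p) - x) := by
    intro j
    by_cases hinj : Function.Injective (Function.update i m j)
    · have hj : j ∈ J := by
        simp only [hJ, Finset.mem_sdiff, Finset.mem_univ, Finset.mem_image, Finset.mem_erase,
          true_and, and_true, not_exists, not_and]
        intro p hp hpj
        exact hp (hinj (by simp [hp, hpj]))
      have hJ' : Finset.univ \ Finset.univ.image (Function.update i m j) = J.erase j := by
        ext l
        simp only [hJ, Finset.mem_sdiff, Finset.mem_univ, Finset.mem_image, Finset.mem_erase,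
          true_and, and_true, not_exists, not_and]
        constructor
        · intro h
          refine ⟨fun hl => h m (by simp [hl]), fun p hp hpl => h p (by simp [hp, hpl])⟩
        · rintro ⟨hl, h⟩ p hp
          rcases eq_or_ne p m with rfl | hpm
          · exact hl (by simpa using hp.symm)
          · exact h p hpm (by simpa [hpm] using hp)
      rw [hc _ hinj, hJ', ← Finset.mul_prod_erase _ _ hj, mul_assoc]
    · rw [hc0 _ hinj, f.map_eq_zero_of_not_injective, mul_zero, mul_zero]
      intro h
      exact hinj fun p q hpq => h (by simp [hpq])
  have h2 : ∑ j, w j * f (fun p => X (Function.update i m j p) - x) = 0 := by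
    have h3 : ∀ j, (fun p => X (Function.update i m j p) - x) =
        Function.update (fun p => X (i p) - x) m (X j - x) := by
      intro j
      funext p
      rcases eq_or_ne p m with rfl | hp
      · simp
      · simp [hp]
    have h4 : ∑ j, w j • (X j - x) = 0 := by
      simp only [smul_sub, Finset.sum_sub_distrib, hx, ← Finset.sum_smul, hw1, one_smul, sub_self]
    have h5 := congrArg (f.toMultilinearMap.toLinearMap (fun p => X (i p) - x) m) h4
    rw [map_sum, map_zero] at h5
    simp only [map_smul, smul_eq_mul, MultilinearMap.toLinearMap_apply] at h5
    simp only [h3]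
    exact h5
  simp only [← h1, ← Finset.mul_sum] at h2
  exact (mul_eq_zero.1 h2).resolve_left (Finset.prod_ne_zero_iff.2 fun j _ => hw j)

/-! ### Barycentric geometry and the test coefficients -/

/-- The vertices of a nondegenerate simplex as an affine basis. -/
noncomputable def vertexBasis {n : ℕ} (T : Affine.Simplex ℝ (Space n) n) :
    AffineBasis (Fin (n + 1)) ℝ (Space n) :=
  ⟨T.points, T.independent, T.span_eq_top (by simp)⟩

theorem sum_coord_smul_points {n : ℕ} (T : Affine.Simplex ℝ (Space n) n) (x : Space n) :
    ∑ j, (vertexBasis T).coord j x • T.points j = x :=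
  (vertexBasis T).linear_combination_coord_eq_self x

theorem coord_mem_polyFun_one {n : ℕ} (b : AffineBasis (Fin (n + 1)) ℝ (Space n))
    (j : Fin (n + 1)) : (fun x => b.coord j x) ∈ polyFun n 1 := by
  have h : ∀ x : Space n, b.coord j x = b.coord j 0 +
      ∑ q, x q * (b.coord j).linear (EuclideanSpace.basisFun (Fin n) ℝ q) := by
    intro x
    have h1 := (EuclideanSpace.basisFun (Fin n) ℝ).sum_repr x
    have h2 := congrArg (b.coord j).linear h1
    rw [map_sum] at h2
    simp only [map_smul, smul_eq_mul, EuclideanSpace.basisFun_repr] at h2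
    have h3 : b.coord j x = (b.coord j).linear x + b.coord j 0 := by
      simpa using (b.coord j).map_vadd 0 x
    rw [h2, h3, add_comm]
  rw [funext h]
  refine Submodule.add_mem _ (polyFun_mono zero_le_one (const_mem_polyFun _)) ?_
  refine sum_mem_polyFun _ _ fun q _ => ?_
  exact polyFun_mul_mem (t := 0) (coord_mem_polyFun q) (const_mem_polyFun _)

theorem sum_smul_mem_convexHull {n : ℕ} (T : Affine.Simplex ℝ (Space n) n) {w : Fin (n + 1) → ℝ}
    (hw : ∀ i, 0 ≤ w i) (hw1 : ∑ i, w i = 1) {j : Fin (n + 1)} (hj : w j = 0) :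
    ∑ i, w i • T.points i ∈ convexHull ℝ (T.points '' {j}ᶜ) := by
  rw [← Finset.add_sum_erase _ _ (Finset.mem_univ j)] at hw1 ⊢
  rw [hj, zero_add] at hw1
  rw [hj, zero_smul, zero_add]
  refine (convex_convexHull ℝ _).sum_mem (fun i _ => hw i) hw1 fun i hi => ?_
  exact subset_convexHull ℝ _ ⟨i, by simpa using Finset.ne_of_mem_erase hi, rfl⟩

theorem apply_sub_eq_zero_of_traceVanishes {n k : ℕ} {T : Affine.Simplex ℝ (Space n) n}
    {ω : Form n k} (hω : TraceVanishesOnBoundary T ω) {i : Fin k → Fin (n + 1)} {j : Fin (n + 1)}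
    (hij : ∀ m, i m ≠ j) {x : Space n} (hx : x ∈ convexHull ℝ (T.points '' {j}ᶜ)) :
    ω x (fun m => T.points (i m) - x) = 0 := by
  refine hω j x hx _ fun m => ?_
  rw [← direction_affineSpan, ← vsub_eq_sub]
  exact AffineSubspace.vsub_mem_direction
    (subset_affineSpan ℝ _ ⟨i m, by simpa using hij m, rfl⟩)
    (convexHull_subset_affineSpan _ hx)

/-- An injective tuple misses `n + 1 - k` vertices; dividing by their coordinates lowers the degree
from `r` to `r - n + k - 1`. If that is negative, the quotient is zero. -/
theorem exists_dual_coefficient {n k r : ℕ} (hr : 1 ≤ r) {T : Affine.Simplex ℝ (Space n) n}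
    {ω : Form n k} (hω : ω ∈ trimmedForms n k r) (hω_trace : TraceVanishesOnBoundary T ω)
    (i : Fin k → Fin (n + 1)) :
    ∃ B ∈ polyFun n ((r : ℤ) - n + k - 1), (¬ Function.Injective i → B = 0) ∧
      (Function.Injective i → ∀ x, ω x (fun m => T.points (i m) - x) =
        (∏ j ∈ Finset.univ \ Finset.univ.image i, (vertexBasis T).coord j x) * B x) := by
  by_cases hi : Function.Injective i
  swap
  · exact ⟨0, Submodule.zero_mem _, fun _ => rfl, fun h => absurd h hi⟩
  obtain ⟨p, hp, hpe⟩ := sub_mem_polyFun_of_trimmedForms hω (fun m => T.points (i m))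
  obtain ⟨P, hP, hPe⟩ := exists_isHomogeneous_eval_eq hp (fun j q => T.points j q)
  have hPw : ∀ w : Fin (n + 1) → ℝ, ∑ j, w j = 1 → MvPolynomial.eval w P =
      ω (∑ j, w j • T.points j) (fun m => T.points (i m) - ∑ j, w j • T.points j) := by
    intro w hw
    rw [← hPe w hw]
    refine Eq.trans ?_ (hpe _).symm
    congr 2
    funext q
    simp
  set J := Finset.univ \ Finset.univ.image i with hJ
  obtain ⟨Q, hQ, hQd⟩ := exists_eq_prod_X_mul hr hP J fun j hj w hw hw1 hwj => by
    rw [hPw w hw1]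
    refine apply_sub_eq_zero_of_traceVanishes hω_trace (j := j) (fun m hm => ?_)
      (sum_smul_mem_convexHull T hw hw1 hwj)
    simp only [hJ, Finset.mem_sdiff, Finset.mem_image] at hj
    exact hj.2 ⟨m, Finset.mem_univ m, hm⟩
  have hcard : J.card + k = n + 1 := by
    have := Finset.card_sdiff_add_card_eq_card (Finset.subset_univ (Finset.univ.image i))
    rw [Finset.card_image_of_injective _ hi] at this
    simpa using this
  refine ⟨fun x => MvPolynomial.eval (fun j => (vertexBasis T).coord j x) Q,
    eval_comp_mem_polyFun (fun d hd => ?_) fun j => coord_mem_polyFun_one _ j,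
    fun h => absurd hi h, fun _ x => ?_⟩
  · have := hQd d hd
    omega
  · have h := hPw (fun j => (vertexBasis T).coord j x) ((vertexBasis T).sum_coord_apply_eq_one x)
    rw [sum_coord_smul_points] at h
    rw [← h, hQ]
    simp

/-- The test form is `B` times a constant form `θ` whose wedge with `ω x` is evaluation at `v`. -/
theorem integral_mul_eq_zero {n k : ℕ} (hk : k ≤ n) {s : ℤ} {S : Set (Space n)}
    {e : Space n → ℝ} {ω : Form n k}
    (h : ∀ η ∈ polyForms n (n - k) s,
      integralForm (Nat.add_sub_of_le hk) S (fun x => e x • wedge (ω x) (η x)) = 0)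
    (v : Fin k → Space n) {B : Space n → ℝ} (hB : B ∈ polyFun n s) :
    ∫ x in S, e x * (B x * ω x v) = 0 := by
  obtain ⟨θ, hθ⟩ := exists_wedge_eq_apply (Nat.add_sub_of_le hk) v
  have h1 := h (fun x => B x • θ) fun u => by
    obtain ⟨p, hp, hpe⟩ := hB
    refine ⟨θ u • p, Submodule.smul_mem _ _ hp, fun x => ?_⟩
    rw [MvPolynomial.smul_eval, ← hpe, mul_comm]
    rfl
  rw [← h1, integralForm]
  refine integral_congr_ae (Filter.Eventually.of_forall fun x => ?_)
  change _ = e x * wedgeEval (ω x) _ (B x • θ)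
  rw [map_smul, wedgeEval_apply, hθ]
  rfl

/-- The vectors `X_j - x` span: the barycentric coordinates of `v + x` express `v` through them. -/
theorem form_eq_zero_of_apply_sub_eq_zero {n k : ℕ} {T : Affine.Simplex ℝ (Space n) n}
    {f : Alt n k} {x : Space n}
    (h : ∀ i : Fin k → Fin (n + 1), f (fun m => T.points (i m) - x) = 0) :
    f = 0 := by
  have hz : ∑ j, (vertexBasis T).coord j x • (T.points j - x) = 0 := by
    simp only [smul_sub, Finset.sum_sub_distrib, sum_coord_smul_points, ← Finset.sum_smul]
    rw [(vertexBasis T).sum_coord_apply_eq_one x, one_smul, sub_self]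
  ext v
  have hv : v = fun m => ∑ j, (vertexBasis T).coord j (v m + x) • (T.points j - x) := by
    funext m
    simp only [smul_sub, Finset.sum_sub_distrib, sum_coord_smul_points, ← Finset.sum_smul]
    rw [(vertexBasis T).sum_coord_apply_eq_one, one_smul, add_sub_cancel_right]
  rw [hv]
  have h1 := f.toMultilinearMap.map_sum
    (fun m j => (vertexBasis T).coord j (v m + x) • (T.points j - x))
  rw [AlternatingMap.coe_multilinearMap] at h1
  rw [h1]
  refine Finset.sum_eq_zero fun i _ => ?_
  have h2 := f.toMultilinearMap.map_smul_univ (fun m => (vertexBasis T).coord (i m) (v m + x))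
    (fun m => T.points (i m) - x)
  rw [AlternatingMap.coe_multilinearMap] at h2
  rw [h2, h, smul_zero]

theorem interior_closedInterior_eq {n : ℕ} (T : Affine.Simplex ℝ (Space n) n) :
    interior T.closedInterior = {x | ∀ j, 0 < (vertexBasis T).coord j x} := by
  rw [← Affine.Simplex.convexHull_eq_closedInterior]
  exact (vertexBasis T).interior_convexHull

end FEEC

/-! ### Positivity argument -/

open FEEC in
theorem mainTheorem3 (n k r : ℕ) (hk : k ≤ n) (hr : 1 ≤ r)
    (T : Affine.Simplex ℝ (FEEC.Space n) n)
    (e : FEEC.Space n → ℝ)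
    (he_int : MeasureTheory.IntegrableOn e T.closedInterior)
    (he_pos : ∀ x ∈ T.closedInterior, 0 < e x)
    (ω : FEEC.Form n k)
    (hω : ω ∈ FEEC.trimmedForms n k (r : ℤ))
    (hω_trace : FEEC.TraceVanishesOnBoundary T ω)
    (h : ∀ η ∈ FEEC.polyForms n (n - k) ((r : ℤ) - n + k - 1),
      FEEC.integralForm (Nat.add_sub_of_le hk) T.closedInterior
        (fun x => e x • FEEC.wedge (ω x) (η x)) = 0) :
    ω = 0 := by
  choose B hB hB0 hBe using exists_dual_coefficient hr hω hω_trace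
  set U := interior T.closedInterior with hU
  have hUo : IsOpen U := isOpen_interior
  have hUpos : ∀ x ∈ U, ∀ j, 0 < (vertexBasis T).coord j x := by
    intro x hx
    rw [hU, interior_closedInterior_eq] at hx
    exact hx
  have hUne : U.Nonempty := by
    rw [hU, ← Affine.Simplex.convexHull_eq_closedInterior]
    exact ⟨_, (vertexBasis T).centroid_mem_interior_convexHull⟩
  have hUae : U =ᵐ[volume] T.closedInterior := by
    rw [hU, ← Affine.Simplex.convexHull_eq_closedInterior]
    exact interior_ae_eq_of_null_frontier ((convex_convexHull ℝ _).addHaar_frontier volume)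
  -- All tuples are summed, not only increasing ones, so that slots can be updated independently;
  -- noninjective tuples contribute zero.
  let G : Space n → ℝ := fun x => ∑ i, B i x * ω x (fun m => T.points (i m))
  have hGi : ∀ i, Continuous fun x => B i x * ω x (fun m => T.points (i m)) := fun i =>
    (continuous_of_mem_polyFun (hB i)).mul
      (continuous_of_mem_polyFun (apply_mem_polyFun_of_trimmedForms hω _))
  have hGc : Continuous G := continuous_finsetSum _ fun i _ => hGi i
  have hint : ∀ g : Space n → ℝ, Continuous g →
      IntegrableOn (fun x => e x * g x) T.closedInterior := fun g hg =>
    he_int.mul_continuousOn hg.continuousOn T.isCompact_closedInterior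
  have hG0 : ∫ x in U, e x * G x = 0 := by
    rw [setIntegral_congr_set hUae]
    simp only [G, Finset.mul_sum]
    rw [integral_finsetSum _ fun i _ => hint _ (hGi i)]
    exact Finset.sum_eq_zero fun i _ => integral_mul_eq_zero hk h _ (hB i)
  have hGe : ∀ x ∈ U, G x = ∑ i, B i x * ω x (fun m => T.points (i m) - x) := by
    intro x hx
    refine (sum_mul_apply_sub (ω x) (fun i => B i x) (fun m i => ?_) T.points x).symm
    exact sum_update_eq_zero (ω x) (X := T.points) (x := x) (c := fun i => B i x)
      (w := fun j => (vertexBasis T).coord j x)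
      (fun j => (hUpos x hx j).ne') ((vertexBasis T).sum_coord_apply_eq_one x)
      (sum_coord_smul_points T x) (fun i hi => by simp [hB0 i hi])
      (fun i hi => hBe i hi x) m i
  -- For injective `i` the term is `(∏ λ_j) B_i²`.
  have hterm : ∀ x ∈ U, ∀ i, 0 ≤ B i x * ω x (fun m => T.points (i m) - x) := by
    intro x hx i
    by_cases hi : Function.Injective i
    · rw [hBe i hi, mul_left_comm]
      exact mul_nonneg (Finset.prod_nonneg fun j _ => (hUpos x hx j).le) (mul_self_nonneg _)
    · simp [hB0 i hi]
  have hGnn : ∀ x ∈ U, 0 ≤ e x * G x := fun x hx => by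
    rw [hGe x hx]
    exact mul_nonneg (he_pos x (interior_subset hx)).le
      (Finset.sum_nonneg fun i _ => hterm x hx i)
  have hGae : G =ᵐ[volume.restrict U] fun _ => 0 := by
    rw [setIntegral_eq_zero_iff_of_nonneg_ae (ae_restrict_of_forall_mem hUo.measurableSet hGnn)
      ((hint G hGc).mono_set interior_subset)] at hG0
    filter_upwards [hG0, ae_restrict_mem hUo.measurableSet] with x hx hxU
    exact (mul_eq_zero.1 hx).resolve_left (he_pos x (interior_subset hxU)).ne'
  have hGU : Set.EqOn G (fun _ => 0) U :=
    Measure.eqOn_open_of_ae_eq hGae hUo hGc.continuousOn continuousOn_const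
  have hωU : ∀ x ∈ U, ω x = 0 := by
    intro x hx
    refine form_eq_zero_of_apply_sub_eq_zero (T := T) (x := x) fun i => ?_
    have h0 := hGU hx
    rw [hGe x hx] at h0
    have h1 := (Finset.sum_eq_zero_iff_of_nonneg fun i _ => hterm x hx i).1 h0 i
      (Finset.mem_univ i)
    -- Whichever factor of the zero term vanishes, `ω` does too, being a multiple of `B i x`.
    by_cases hi : Function.Injective i
    · rcases mul_eq_zero.1 h1 with h2 | h2
      · rw [hBe i hi, h2, mul_zero]
      · exact h2
    · exact (ω x).map_eq_zero_of_not_injective _ fun hinj =>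
        hi fun p q hpq => hinj (by simp [hpq])
  funext x
  ext v
  exact congrFun (eq_zero_of_mem_polyFun (apply_mem_polyFun_of_trimmedForms hω v) hUo hUne
    fun y hy => by simp [hωU y hy]) x
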